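/- Let $\lambda$ be Lebesgue measure on $\mathbb{R}$ and $G=\frac{1+\sqrt5}{2}$. Define $T:[0,\frac12]\to[0,\frac12]$ and $T_o,T_e:[-\frac12,\frac12]\to[-\frac12,\frac12]$ by $T(0)=T_o(0)=T_e(0)=0$ and, for $x\neq 0$, $$T(x)=\Big|\frac1x-\Big\lfloor\frac1x+\frac12\Big\rfloor\Big|,\qquad T_o(x)=\frac1x-\Big\lfloor\frac1x+\frac12\Big\rfloor,\qquad T_e(x)=\frac1{|x|}-\Big\lfloor\frac1{|x|}+\frac12\Big\rfloor .$$ Let $\mu$ be the probability measure on $[0,\frac12]$, and $\mu_o,\mu_e$ the probability measures on $[-\frac12,\frac12]$, given by $$d\mu=\frac{1}{\log G}\Big(\frac1{G+x}+\frac1{G+1-x}\Big)dx,\qquad d\mu_o=\frac{1}{2\log G}\Big(\frac1{G+|x|}+\frac1{G+1-|x|}\Big)dx,$$ and $d\mu_e=h_e(x)\,dx$, where $h_e(x)=\frac{1}{\log G}\cdot\frac{1}{G+x}$ for $0<x<\frac12$ and $h_e(x)=\frac{1}{\log G}\cdot\frac{1}{G+x+1}$ for $-\frac12<x<0$. Then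 there are absolute constants $C_1,C_2,C_3$ such that, for every integer $n\ge 0$: (i) $\big|\lambda(T^{-n}E)-\frac12\mu(E)\big|\le C_1\,\mu(E)\,(0.288)^n$ for every Borel set $E\subseteq[0,\frac12]$; (ii) $\big|\lambda(T_o^{-n}E)-\mu_o(E)\big|\le C_2\,\mu_o(E)\,(0.288)^n$ for every Borel set $E\subseteq[-\frac12,\frac12]$; (iii) $\big|\lambda(T_e^{-n}E)-\mu_e(E)\big|\le C_3\,\mu_e(E)\,(0.234)^n$ for every Borel set $E\subseteq[-\frac12,\frac12]$. Here $f^{-n}E$ denotes the preimage of $E$ under the $n$-th iterate of $f$, in the domain of $f$. -/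

import Mathlib

open MeasureTheory Set

noncomputable section

namespace NICF

/-- The folded nearest-integer continued fraction map, a self-map of `[0, 1/2]`. -/
def T (x : ℝ) : ℝ :=
  if x = 0 then 0 else |1 / x - (⌊1 / x + 1 / 2⌋ : ℝ)|

/-- The odd (Nakada–Ito–Tanaka) map, a self-map of `[-1/2, 1/2]`. -/
def To (x : ℝ) : ℝ :=
  if x = 0 then 0 else 1 / x - (⌊1 / x + 1 / 2⌋ : ℝ)

/-- The even (Rieger) map, a self-map of `[-1/2, 1/2]`. -/
def Te (x : ℝ) : ℝ :=
  if x = 0 then 0 else 1 / |x| - (⌊1 / |x| + 1 / 2⌋ : ℝ)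

/-- The domain of `T`. -/
abbrev I : Set ℝ := Icc 0 (1 / 2)

/-- The common domain of `To` and `Te`. -/
abbrev I₀ : Set ℝ := Icc (-(1 / 2)) (1 / 2)

theorem sub_floor_mem (t : ℝ) : t - (⌊t + 1 / 2⌋ : ℝ) ∈ I₀ := by
  have h1 := Int.floor_le (t + 1 / 2)
  have h2 := Int.lt_floor_add_one (t + 1 / 2)
  constructor <;> linarith

theorem mapsTo_T : MapsTo T I I := by
  intro x _
  unfold T
  split_ifs
  · constructor <;> norm_num
  · exact ⟨abs_nonneg _, abs_le.2 (sub_floor_mem _)⟩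

theorem mapsTo_To : MapsTo To I₀ I₀ := by
  intro x _
  unfold To
  split_ifs
  · constructor <;> norm_num
  · exact sub_floor_mem _

theorem mapsTo_Te : MapsTo Te I₀ I₀ := by
  intro x _
  unfold Te
  split_ifs
  · constructor <;> norm_num
  · exact sub_floor_mem _

/-- The preimage `f⁻ⁿ E` of `E` under the `n`-th iterate of a self-map `f` of `D`. -/
def iterPreimage (f : ℝ → ℝ) (D : Set ℝ) (n : ℕ) (E : Set ℝ) : Set ℝ :=
  {x ∈ D | f^[n] x ∈ E}

/-- The density of the `T`-invariant probability measure; `G` is the golden ratio. -/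
def density (x : ℝ) : ℝ :=
  1 / Real.log Real.goldenRatio *
    (1 / (Real.goldenRatio + x) + 1 / (Real.goldenRatio + 1 - x))

/-- The density of the `To`-invariant probability measure. -/
def densityO (x : ℝ) : ℝ :=
  1 / (2 * Real.log Real.goldenRatio) *
    (1 / (Real.goldenRatio + |x|) + 1 / (Real.goldenRatio + 1 - |x|))

/-- The density of the `Te`-invariant probability measure. -/
def densityE (x : ℝ) : ℝ :=
  1 / Real.log Real.goldenRatio *
    (if 0 ≤ x then 1 / (Real.goldenRatio + x) else 1 / (Real.goldenRatio + x + 1))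

/-- The probability measure `μ` on `[0, 1/2]`. -/
def μ : Measure ℝ := (volume.restrict I).withDensity fun x => ENNReal.ofReal (density x)

/-- The probability measure `μ_o` on `[-1/2, 1/2]`. -/
def μo : Measure ℝ := (volume.restrict I₀).withDensity fun x => ENNReal.ofReal (densityO x)

/-- The probability measure `μ_e` on `[-1/2, 1/2]`. -/
def μe : Measure ℝ := (volume.restrict I₀).withDensity fun x => ENNReal.ofReal (densityE x)

end NICF

end

namespace NICF

open scoped ENNReal

local notation "G" => Real.goldenRatio

/-! The signs can be folded away: `|To x| = |Te x| = T |x|`, so starting from the uniform measure on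
`I₀` the law of `To^[n]` stays symmetric and its density is `iterDensity n |x|`, an iterate of the
transfer operator of `T`. Dividing by the invariant density turns that operator into the averaging
operator `U`, whose weights sum to 1. The theorem reduces to exponential decay of the oscillation of
`U^n γ`: a normalized density of small oscillation is uniformly close to its mean, which gives an
error proportional to the invariant measure of `E`.

The decay is `GaugeLip.map_U`. Oscillation is compared with that of one explicit decreasing
function, `gauge`, chosen so that `U gauge` telescopes to a closed form (`U_gauge`). Passing from `U
γ x` to `U γ y`, the weights are moved first and the branch points second. The first move is
controlled by stochastic monotonicity (`avg_le_avg`) applied to the antitone functions `D * gauge ±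
γ`. In the second, only the decreasing plus branches move `gauge` upwards; the minus branches cost
an extra term linear in `y - x`. Everything is thus bounded by `U gauge y - U gauge x` plus that
term, and an elementary estimate gives the factor 0.234.

This settles `To`. The map `T` follows by applying it to symmetric sets, and `Te` from `Te^[n+1] =
Te ∘ To^[n]` together with `μo (Te ⁻¹' E) = μe E`. All three rates are in fact 0.234; the rate 0.288
is a weakening. -/

/-! ### Telescoping sums -/

/-- The general term of the telescoping series with sum `1 / c`. -/
noncomputable def tel (k : ℕ) (c : ℝ) : ℝ := 1 / (k + c) - 1 / (k + 1 + c)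

theorem tel_nonneg (k : ℕ) {c : ℝ} (hc : 0 < c) : 0 ≤ tel k c := by
  unfold tel
  rw [sub_nonneg]
  exact one_div_le_one_div_of_le (by positivity) (by linarith)

theorem tendsto_one_div_nat_add (c : ℝ) :
    Filter.Tendsto (fun k : ℕ => 1 / ((k : ℝ) + c)) Filter.atTop (nhds 0) := by
  simp only [one_div]
  exact tendsto_inv_atTop_zero.comp
    (Filter.tendsto_atTop_add_const_right _ _ tendsto_natCast_atTop_atTop)

theorem hasSum_tel {c : ℝ} (hc : 0 < c) : HasSum (fun k => tel k c) (1 / c) := by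
  rw [hasSum_iff_tendsto_nat_of_nonneg (fun k => tel_nonneg k hc)]
  have h : ∀ n : ℕ, ∑ k ∈ Finset.range n, tel k c = 1 / c - 1 / ((n : ℝ) + c) := by
    intro n
    induction n with
    | zero => simp
    | succ n ih => rw [Finset.sum_range_succ, ih, tel]; push_cast; ring
  simp_rw [h]
  simpa using (tendsto_one_div_nat_add c).const_sub (1 / c)

/-! ### The normalized transfer operator -/

theorem golden_bounds : 1.618 < G ∧ G < 1.6181 := by
  have h := Real.goldenRatio_sq
  have h1 := Real.one_lt_goldenRatio
  constructor <;> nlinarith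

/-- The reciprocal of the (unnormalized) invariant density. -/
noncomputable def invH (x : ℝ) : ℝ := (G + x) * (G + 1 - x) / (2 * G + 1)

/-- The weight of the branch `x ↦ 1 / (k + 2 + x)`. -/
noncomputable def cP (k : ℕ) (x : ℝ) : ℝ := invH x * tel k (G + x)

/-- The weight of the branch `x ↦ 1 / (k + 3 - x)`. -/
noncomputable def cM (k : ℕ) (x : ℝ) : ℝ := invH x * tel k (G + 1 - x)

/-- Averaging over the branches at `z` with the weights at `x`. -/
noncomputable def avg (γ : ℝ → ℝ) (x z : ℝ) : ℝ :=
  ∑' k : ℕ, (cP k x * γ (1 / (k + 2 + z)) + cM k x * γ (1 / (k + 3 - z)))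

/-- The transfer operator of `T`, normalized by the invariant density. -/
noncomputable def U (γ : ℝ → ℝ) (x : ℝ) : ℝ := avg γ x x

theorem invH_pos {x : ℝ} (hx : x ∈ I) : 0 < invH x := by
  obtain ⟨h0, h1⟩ := hx
  have := golden_bounds
  unfold invH
  exact div_pos (mul_pos (by linarith) (by linarith)) (by linarith)

theorem cP_nonneg (k : ℕ) {x : ℝ} (hx : x ∈ I) : 0 ≤ cP k x :=
  mul_nonneg (invH_pos hx).le (tel_nonneg k (by linarith [hx.1, golden_bounds.1]))

theorem cM_nonneg (k : ℕ) {x : ℝ} (hx : x ∈ I) : 0 ≤ cM k x :=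
  mul_nonneg (invH_pos hx).le (tel_nonneg k (by linarith [hx.2, golden_bounds.1]))

theorem hasSum_cM {x : ℝ} (hx : x ∈ I) : HasSum (fun k => cM k x) ((G + x) / (2 * G + 1)) := by
  have hg := golden_bounds
  have h := (hasSum_tel (c := G + 1 - x) (by linarith [hx.2])).mul_left (invH x)
  have h1 : G + 1 - x ≠ 0 := by linarith [hx.2]
  have e : (G + x) / (2 * G + 1) = invH x * (1 / (G + 1 - x)) := by
    rw [invH, mul_one_div, div_div, mul_div_mul_right _ _ h1]
  rwa [e]

theorem hasSum_cP {x : ℝ} (hx : x ∈ I) :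
    HasSum (fun k => cP k x) ((G + 1 - x) / (2 * G + 1)) := by
  have hg := golden_bounds
  have h := (hasSum_tel (c := G + x) (by linarith [hx.1])).mul_left (invH x)
  have h1 : G + x ≠ 0 := by linarith [hx.1]
  have e : (G + 1 - x) / (2 * G + 1) = invH x * (1 / (G + x)) := by
    rw [invH, mul_one_div, div_div, mul_comm (G + x), mul_div_mul_right _ _ h1]
  rwa [e]

theorem hasSum_weights {x : ℝ} (hx : x ∈ I) : HasSum (fun k => cP k x + cM k x) 1 := by
  have hg := golden_bounds
  convert (hasSum_cP hx).add (hasSum_cM hx) using 1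
  have : 2 * G + 1 ≠ 0 := by linarith
  field_simp
  ring

theorem one_div_add_mem (k : ℕ) {z : ℝ} (hz : z ∈ I) : 1 / ((k : ℝ) + 2 + z) ∈ I := by
  have hk : (0 : ℝ) ≤ k := k.cast_nonneg
  have := hz.1
  refine ⟨by positivity, ?_⟩
  exact one_div_le_one_div_of_le (by norm_num) (by linarith)

theorem one_div_sub_mem (k : ℕ) {z : ℝ} (hz : z ∈ I) : 1 / ((k : ℝ) + 3 - z) ∈ I := by
  have hk : (0 : ℝ) ≤ k := k.cast_nonneg
  have := hz.2
  refine ⟨one_div_nonneg.2 (by linarith), ?_⟩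
  exact one_div_le_one_div_of_le (by norm_num) (by linarith)

theorem summable_avg {γ : ℝ → ℝ} {B x z : ℝ} (hB : ∀ s ∈ I, |γ s| ≤ B) (hx : x ∈ I) (hz : z ∈ I) :
    Summable fun k : ℕ => cP k x * γ (1 / (k + 2 + z)) + cM k x * γ (1 / (k + 3 - z)) := by
  refine Summable.of_norm_bounded ((hasSum_weights hx).summable.mul_right B) fun k => ?_
  rw [Real.norm_eq_abs, add_mul]
  refine (abs_add_le _ _).trans (add_le_add ?_ ?_)
  · rw [abs_mul, abs_of_nonneg (cP_nonneg k hx)]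
    exact mul_le_mul_of_nonneg_left (hB _ (one_div_add_mem k hz)) (cP_nonneg k hx)
  · rw [abs_mul, abs_of_nonneg (cM_nonneg k hx)]
    exact mul_le_mul_of_nonneg_left (hB _ (one_div_sub_mem k hz)) (cM_nonneg k hx)

/-! ### Stochastic monotonicity of the weights -/

/-- Since `(G + t) * (G + 1 - t) = (G + 1/2)^2 - (1/2 - t)^2`, the product depends only on `(1/2 -
t)^2`, which decreases on `I`. With `b = n + G + 1/2` it is the total weight of the branches of
index at least `n`. -/
theorem invH_mul_add_le {b x y : ℝ} (hb : G + 1 / 2 ≤ b) (hx : x ∈ I) (hy : y ∈ I) (hxy : x ≤ y) :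
    invH x * (1 / (b - 1 / 2 + x) + 1 / (b + 1 / 2 - x)) ≤
      invH y * (1 / (b - 1 / 2 + y) + 1 / (b + 1 / 2 - y)) := by
  have hg := golden_bounds
  obtain ⟨hx0, hx1⟩ := hx
  obtain ⟨hy0, hy1⟩ := hy
  have key : ∀ t : ℝ, 0 ≤ t → t ≤ 1 / 2 →
      invH t * (1 / (b - 1 / 2 + t) + 1 / (b + 1 / 2 - t)) =
        2 * b / (2 * G + 1) * (1 - (b ^ 2 - (G + 1 / 2) ^ 2) / (b ^ 2 - (1 / 2 - t) ^ 2)) := by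
    intro t h0 h1
    have e1 : b - 1 / 2 + t ≠ 0 := by linarith
    have e2 : b + 1 / 2 - t ≠ 0 := by linarith
    have e3 : b ^ 2 - (1 / 2 - t) ^ 2 ≠ 0 := by
      have : b ^ 2 - (1 / 2 - t) ^ 2 = (b - 1 / 2 + t) * (b + 1 / 2 - t) := by ring
      rw [this]; exact mul_ne_zero e1 e2
    have e4 : 2 * G + 1 ≠ 0 := by linarith
    unfold invH
    rw [one_sub_div e3, show b ^ 2 - (1 / 2 - t) ^ 2 = (b - 1 / 2 + t) * (b + 1 / 2 - t) by ring,
      one_div_add_one_div e1 e2, div_mul_div_comm, div_mul_div_comm]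
    congr 1
    ring
  rw [key x hx0 hx1, key y hy0 hy1]
  refine mul_le_mul_of_nonneg_left ?_ (div_nonneg (by linarith) (by linarith))
  refine sub_le_sub_left (div_le_div_of_nonneg_left ?_ ?_ ?_) _ <;> nlinarith

/-- Both factors increase on `I`. With `a = n + 1 + G` the product is the weight left after the plus
branch of index `n`, starting from `cM n`. -/
theorem invH_mul_symm_le {a x y : ℝ} (ha : G ≤ a) (hx : x ∈ I) (hy : y ∈ I) (hxy : x ≤ y) :
    invH x * (1 / (a + x) + 1 / (a - x)) ≤ invH y * (1 / (a + y) + 1 / (a - y)) := by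
  have hg := golden_bounds
  obtain ⟨hx0, hx1⟩ := hx
  obtain ⟨hy0, hy1⟩ := hy
  have key : ∀ t : ℝ, 0 ≤ t → t ≤ 1 / 2 →
      1 / (a + t) + 1 / (a - t) = 2 * a / (a ^ 2 - t ^ 2) := by
    intro t h0 h1
    rw [one_div_add_one_div (by linarith) (by linarith)]
    congr 1 <;> ring
  rw [key x hx0 hx1, key y hy0 hy1]
  refine mul_le_mul ?_ ?_ (div_nonneg (by linarith) (by nlinarith)) (invH_pos ⟨hy0, hy1⟩).le
  · unfold invH
    exact div_le_div_of_nonneg_right (by nlinarith) (by linarith)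
  · refine div_le_div_of_nonneg_left (by linarith) ?_ ?_ <;> nlinarith

/-- Moving the weights from `x` to `y ≥ x` shifts mass to smaller branch points. -/
theorem avg_le_avg {f : ℝ → ℝ} {B x y z : ℝ} (hB : ∀ s ∈ I, |f s| ≤ B) (hf : AntitoneOn f I)
    (hx : x ∈ I) (hy : y ∈ I) (hz : z ∈ I) (hxy : x ≤ y) : avg f x z ≤ avg f y z := by
  have hg := golden_bounds
  have hz0 := hz.1
  have hz1 := hz.2
  set R : ℕ → ℝ → ℝ := fun n t => invH t * (1 / (n + (G + t)) + 1 / (n + (G + 1 - t))) with hR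
  have hRle : ∀ n, R n x ≤ R n y := by
    intro n
    have hn : (0 : ℝ) ≤ n := n.cast_nonneg
    have := invH_mul_add_le (b := n + G + 1 / 2) (by linarith) hx hy hxy
    simp only [hR]
    convert this using 4 <;> ring
  have hQle : ∀ n : ℕ, invH x * (1 / (n + 1 + (G + x)) + 1 / (n + (G + 1 - x))) ≤
      invH y * (1 / (n + 1 + (G + y)) + 1 / (n + (G + 1 - y))) := by
    intro n
    have hn : (0 : ℝ) ≤ n := n.cast_nonneg
    have := invH_mul_symm_le (a := n + 1 + G) (by linarith) hx hy hxy
    convert this using 4 <;> ring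
  have hR0 : ∀ t ∈ I, R 0 t = 1 := by
    intro t ht
    have e1 : G + t ≠ 0 := by linarith [ht.1]
    have e2 : G + 1 - t ≠ 0 := by linarith [ht.2]
    have e3 : 2 * G + 1 ≠ 0 := by linarith
    simp only [hR, invH, Nat.cast_zero, zero_add]
    rw [one_div_add_one_div e1 e2, div_mul_div_comm]
    refine (div_eq_one_iff_eq (mul_ne_zero e3 (mul_ne_zero e1 e2))).2 ?_
    ring
  -- Summation by parts: the branch points decrease in the order `cP 0, cM 0, cP 1, cM 1, ...` (here
  -- `z ≤ 1/2` matters), and every tail of the weights grows from `x` to `y`. The right side is the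
  -- boundary term, which vanishes in the limit.
  have part : ∀ n : ℕ, ∑ k ∈ Finset.range n,
        (cP k x * f (1 / (k + 2 + z)) + cM k x * f (1 / (k + 3 - z))) -
      ∑ k ∈ Finset.range n, (cP k y * f (1 / (k + 2 + z)) + cM k y * f (1 / (k + 3 - z))) ≤
      (R n y - R n x) * f (1 / (n + 2 + z)) := by
    intro n
    induction n with
    | zero => simp [hR0 x hx, hR0 y hy]
    | succ n ih =>
      have hn : (0 : ℝ) ≤ n := n.cast_nonneg
      rw [Finset.sum_range_succ, Finset.sum_range_succ]
      have m1 := one_div_add_mem n hz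
      have m2 := one_div_sub_mem n hz
      have m3 := one_div_add_mem (n + 1) hz
      have i1 : f (1 / ((n : ℝ) + 2 + z)) ≤ f (1 / ((n : ℝ) + 3 - z)) :=
        hf m2 m1 (one_div_le_one_div_of_le (by linarith) (by linarith))
      have i2 : f (1 / ((n : ℝ) + 3 - z)) ≤ f (1 / (((n + 1 : ℕ) : ℝ) + 2 + z)) :=
        hf m3 m2 (one_div_le_one_div_of_le (by linarith) (by push_cast; linarith))
      have j1 := mul_le_mul_of_nonneg_left i1 (sub_nonneg.2 (hQle n))
      have j2 := mul_le_mul_of_nonneg_left i2 (sub_nonneg.2 (hRle (n + 1)))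
      simp only [hR, cP, cM, tel] at ih j1 j2 ⊢
      push_cast at ih j1 j2 ⊢
      linarith
  have lim : ∀ t, Filter.Tendsto (fun n => R n t) Filter.atTop (nhds 0) := by
    intro t
    have := ((tendsto_one_div_nat_add (G + t)).add
      (tendsto_one_div_nat_add (G + 1 - t))).const_mul (invH t)
    rwa [add_zero, mul_zero] at this
  have lim2 : Filter.Tendsto (fun n : ℕ => (R n y - R n x) * B) Filter.atTop (nhds 0) := by
    simpa using ((lim y).sub (lim x)).mul_const B
  have sx := (summable_avg hB hx hz).hasSum.tendsto_sum_nat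
  have sy := (summable_avg hB hy hz).hasSum.tendsto_sum_nat
  refine sub_nonpos.1 (le_of_tendsto_of_tendsto' (sx.sub sy) lim2 fun n => (part n).trans ?_)
  exact mul_le_mul_of_nonneg_left ((le_abs_self _).trans (hB _ (one_div_add_mem n hz)))
    (sub_nonneg.2 (hRle n))

/-! ### The contraction -/

/-- The function against which oscillations are measured. -/
noncomputable def gauge (u : ℝ) : ℝ := 2 - u + (2 * G - 1) / (1 + u)

/-- `γ` varies on `I` at most `D` times as much as `gauge` does. -/
def GaugeLip (D : ℝ) (γ : ℝ → ℝ) : Prop :=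
  ∀ s ∈ I, ∀ t ∈ I, s ≤ t → |γ s - γ t| ≤ D * (gauge s - gauge t)

theorem gauge_sub {s t : ℝ} (hs : s ∈ I) (ht : t ∈ I) :
    gauge s - gauge t = (t - s) * (1 + (2 * G - 1) / ((1 + s) * (1 + t))) := by
  have h1 : 1 + s ≠ 0 := by linarith [hs.1]
  have h2 : 1 + t ≠ 0 := by linarith [ht.1]
  unfold gauge
  generalize 2 * G - 1 = c
  field_simp
  ring

theorem sub_le_gauge_sub {s t : ℝ} (hs : s ∈ I) (ht : t ∈ I) (hst : s ≤ t) :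
    t - s ≤ gauge s - gauge t := by
  have hg := golden_bounds
  have h1 := hs.1
  have h2 := ht.1
  rw [gauge_sub hs ht]
  refine le_mul_of_one_le_right (by linarith) ?_
  have : 0 ≤ (2 * G - 1) / ((1 + s) * (1 + t)) := div_nonneg (by linarith) (by positivity)
  linarith

theorem antitoneOn_gauge : AntitoneOn gauge I := fun s hs t ht hst => by
  linarith [sub_le_gauge_sub hs ht hst]

theorem GaugeLip.bounded {D : ℝ} {γ : ℝ → ℝ} (hD : 0 ≤ D) (h : GaugeLip D γ) :
    ∃ B, ∀ s ∈ I, |γ s| ≤ B := by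
  have z : (0 : ℝ) ∈ I := by constructor <;> norm_num
  have w : (1 / 2 : ℝ) ∈ I := by constructor <;> norm_num
  refine ⟨|γ 0| + D * (gauge 0 - gauge (1 / 2)), fun s hs => ?_⟩
  have h1 := h 0 z s hs hs.1
  have h2 := mul_le_mul_of_nonneg_left (antitoneOn_gauge hs w hs.2) hD
  have h3 := abs_sub_abs_le_abs_sub (γ s) (γ 0)
  rw [abs_sub_comm] at h3
  linarith

theorem gaugeLip_gauge : GaugeLip 1 gauge := fun s hs t ht hst => by
  rw [one_mul, abs_of_nonneg (sub_nonneg.2 (antitoneOn_gauge hs ht hst))]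

theorem gauge_one_div {m : ℝ} (hm : 2 ≤ m) :
    gauge (1 / m) = (2 * G + 1) * (m + G - 1) * (m + G - 2) / (m * (m + 1)) := by
  have hq := Real.goldenRatio_sq
  have h1 : m ≠ 0 := by linarith
  have h2 : m + 1 ≠ 0 := by linarith
  have h3 : 1 + 1 / m = (m + 1) / m := by field_simp
  rw [gauge, h3]
  generalize G = g at *
  field_simp
  linear_combination (-(4 * m + 2 * g - 3)) * hq

/-- This is what dictates the form of `gauge`: at `1 / m` its numerator cancels the denominator of
the weight, leaving another telescoping term. -/
theorem tel_mul_gauge (k : ℕ) {c : ℝ} (hc : 0 ≤ c) :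
    tel k (G + c) * gauge (1 / (k + 2 + c)) = (2 * G + 1) * tel k (2 + c) := by
  have hg := golden_bounds
  have hk : (0 : ℝ) ≤ k := k.cast_nonneg
  have e1 : (k : ℝ) + (G + c) ≠ 0 := by linarith
  have e2 : (k : ℝ) + 1 + (G + c) ≠ 0 := by linarith
  have e3 : (k : ℝ) + (2 + c) ≠ 0 := by linarith
  have e4 : (k : ℝ) + 1 + (2 + c) ≠ 0 := by linarith
  have e5 : (k : ℝ) + 2 + c ≠ 0 := by linarith
  have e6 : (k : ℝ) + 2 + c + 1 ≠ 0 := by linarith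
  rw [gauge_one_div (by linarith), tel, tel]
  generalize G = g at *
  rw [div_sub_div _ _ e1 e2, div_sub_div _ _ e3 e4,
    div_mul_div_comm, ← mul_div_assoc, div_eq_div_iff (by positivity) (by positivity)]
  ring

theorem U_gauge {x : ℝ} (hx : x ∈ I) :
    U gauge x = 5 - 5 * (5 - 2 * G) / ((2 + x) * (3 - x)) := by
  have hg := golden_bounds
  have hx0 := hx.1
  have hx1 := hx.2
  have hq := Real.goldenRatio_sq
  have term : ∀ k : ℕ, cP k x * gauge (1 / (k + 2 + x)) + cM k x * gauge (1 / (k + 3 - x)) =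
      invH x * (2 * G + 1) * (tel k (2 + x) + tel k (3 - x)) := by
    intro k
    have h1 := tel_mul_gauge k hx0
    have h2 := tel_mul_gauge k (c := 1 - x) (by linarith)
    rw [← add_sub_assoc, ← add_sub_assoc, ← add_sub_assoc,
      show (k : ℝ) + 2 + 1 = k + 3 by ring, show (2 : ℝ) + 1 = 3 by norm_num] at h2
    rw [cP, cM]
    linear_combination invH x * h1 + invH x * h2
  have e1 : 2 + x ≠ 0 := by linarith
  have e2 : 3 - x ≠ 0 := by linarith
  have e3 : 2 * G + 1 ≠ 0 := by linarith
  rw [U, avg, tsum_congr term, tsum_mul_left,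
    ((hasSum_tel (c := 2 + x) (by linarith)).add (hasSum_tel (c := 3 - x) (by linarith))).tsum_eq,
    invH, div_mul_cancel₀ _ e3]
  generalize G = g at *
  field_simp
  linear_combination 5 * hq

/-- The transfer operator contracts oscillations. -/
theorem GaugeLip.map_U {D : ℝ} {γ : ℝ → ℝ} (hD : 0 ≤ D) (h : GaugeLip D γ) :
    GaugeLip (0.234 * D) (U γ) := by
  intro x hx y hy hxy
  have hg := golden_bounds
  have hx0 := hx.1
  have hx1 := hx.2
  have hy0 := hy.1
  have hy1 := hy.2
  obtain ⟨B, hB⟩ := h.bounded hD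
  obtain ⟨B', hB'⟩ := gaugeLip_gauge.bounded zero_le_one
  have sγ : ∀ {s t}, s ∈ I → t ∈ I → _ := fun {s t} hs ht => summable_avg (x := s) (z := t) hB hs ht
  have sψ : ∀ {s t}, s ∈ I → t ∈ I → _ :=
    fun {s t} hs ht => summable_avg (x := s) (z := t) hB' hs ht
  -- moving the weights
  have weights : |avg γ y y - avg γ x y| ≤ D * (avg gauge y y - avg gauge x y) := by
    have lin : ∀ a : ℝ, ∀ s ∈ I, avg (fun u => D * gauge u + a * γ u) s y =
          D * avg gauge s y + a * avg γ s y := by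
      intro a s hs
      unfold avg
      rw [← tsum_mul_left, ← tsum_mul_left,
        ← ((sψ hs hy).mul_left D).tsum_add ((sγ hs hy).mul_left a)]
      exact tsum_congr fun k => by ring
    -- `GaugeLip D γ` says exactly that `D * gauge ± γ` are antitone.
    have mono : ∀ a : ℝ, |a| = 1 →
        D * avg gauge x y + a * avg γ x y ≤ D * avg gauge y y + a * avg γ y y := by
      intro a ha
      rw [← lin a x hx, ← lin a y hy]
      refine avg_le_avg (B := D * B' + B) (fun s hs => ?_) (fun s hs t ht hst => ?_) hx hy hy hxy
      · refine (abs_add_le _ _).trans (add_le_add ?_ ?_)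
        · rw [abs_mul, abs_of_nonneg hD]
          exact mul_le_mul_of_nonneg_left (hB' s hs) hD
        · rw [abs_mul, ha, one_mul]
          exact hB s hs
      · have h1 := h s hs t ht hst
        have h2 : |a * (γ s - γ t)| ≤ D * (gauge s - gauge t) := by rwa [abs_mul, ha, one_mul]
        have h3 := (abs_le.1 h2).1
        linarith
    have p := mono 1 (by norm_num)
    have m := mono (-1) (by norm_num)
    rw [abs_le]
    constructor <;> linarith
  -- moving the branch points
  have points : |avg γ x y - avg γ x x| ≤
      D * ((avg gauge x y - avg gauge x x) + 0.3426 * (y - x)) := by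
    -- Minus branches have denominators at least 5/2, and 4/25 + (2G - 1) * 4/49 < 0.3426.
    have slope : ∀ k : ℕ, gauge (1 / (k + 3 - x)) - gauge (1 / (k + 3 - y)) ≤ 0.3426 * (y - x) := by
      intro k
      have hk : (0 : ℝ) ≤ k := k.cast_nonneg
      have ax : (5 / 2 : ℝ) ≤ k + 3 - x := by linarith
      have ay : (5 / 2 : ℝ) ≤ k + 3 - y := by linarith
      rw [gauge_sub (one_div_sub_mem k hx) (one_div_sub_mem k hy),
        show y - x = (k + 3 - x) - (k + 3 - y) by ring]
      have hpr : (k : ℝ) + 3 - y ≤ k + 3 - x := by linarith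
      generalize (k : ℝ) + 3 - x = p at *
      generalize (k : ℝ) + 3 - y = r at *
      have p0 : p ≠ 0 := by linarith
      have r0 : r ≠ 0 := by linarith
      have p1 : p + 1 ≠ 0 := by linarith
      have r1 : r + 1 ≠ 0 := by linarith
      have e : (1 / r - 1 / p) * (1 + (2 * G - 1) / ((1 + 1 / p) * (1 + 1 / r))) =
          (1 / (p * r) + (2 * G - 1) * (1 / ((p + 1) * (r + 1)))) * (p - r) := by
        generalize 2 * G - 1 = c
        field_simp
      rw [e]
      refine mul_le_mul_of_nonneg_right ?_ (by linarith)
      have b1 : 1 / (p * r) ≤ 1 / (25 / 4) := one_div_le_one_div_of_le (by norm_num) (by nlinarith)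
      have b2 : 1 / ((p + 1) * (r + 1)) ≤ 1 / (49 / 4) :=
        one_div_le_one_div_of_le (by norm_num) (by nlinarith)
      have b3 := mul_le_mul_of_nonneg_left b2 (show 0 ≤ 2 * G - 1 by linarith)
      linarith
    -- On a minus branch `gauge` moves downwards, so replacing its absolute change by the signed one
    -- costs twice that change. The minus weights have total at most 1/2, which later absorbs the 2.
    have bound : ∀ k : ℕ,
        ‖(cP k x * γ (1 / (k + 2 + y)) + cM k x * γ (1 / (k + 3 - y))) -
          (cP k x * γ (1 / (k + 2 + x)) + cM k x * γ (1 / (k + 3 - x)))‖ ≤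
        D * (((cP k x * gauge (1 / (k + 2 + y)) + cM k x * gauge (1 / (k + 3 - y))) -
          (cP k x * gauge (1 / (k + 2 + x)) + cM k x * gauge (1 / (k + 3 - x)))) +
          cM k x * (2 * (0.3426 * (y - x)))) := by
      intro k
      have hk : (0 : ℝ) ≤ k := k.cast_nonneg
      have h1 := h _ (one_div_add_mem k hy) _ (one_div_add_mem k hx)
        (one_div_le_one_div_of_le (by linarith) (by linarith))
      have h2 := h _ (one_div_sub_mem k hx) _ (one_div_sub_mem k hy)
        (one_div_le_one_div_of_le (by linarith) (by linarith))
      have cp := cP_nonneg k hx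
      have cm := cM_nonneg k hx
      have h3 := mul_le_mul_of_nonneg_left (slope k) (mul_nonneg hD cm)
      rw [abs_sub_comm] at h2
      rw [Real.norm_eq_abs, show ∀ a b c d e f : ℝ, (a * b + c * d) - (a * e + c * f) =
        a * (b - e) + c * (d - f) by intros; ring]
      refine (abs_add_le _ _).trans ?_
      rw [abs_mul, abs_mul, abs_of_nonneg cp, abs_of_nonneg cm]
      have h4 := mul_le_mul_of_nonneg_left h1 cp
      have h5 := mul_le_mul_of_nonneg_left h2 cm
      linarith
    have hs := ((((sψ hx hy).hasSum.sub (sψ hx hx).hasSum).add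
      ((hasSum_cM hx).mul_right (2 * (0.3426 * (y - x))))).mul_left D)
    have ht := tsum_of_norm_bounded hs bound
    rw [(sγ hx hy).tsum_sub (sγ hx hx), Real.norm_eq_abs] at ht
    refine ht.trans (mul_le_mul_of_nonneg_left (add_le_add le_rfl ?_) hD)
    rw [div_mul_eq_mul_div, div_le_iff₀ (by linarith)]
    nlinarith [mul_nonneg (sub_nonneg.2 hxy) (sub_nonneg.2 hx1)]
  have total : |U γ y - U γ x| ≤ D * ((U gauge y - U gauge x) + 0.3426 * (y - x)) := by
    have := abs_add_le (avg γ y y - avg γ x y) (avg γ x y - avg γ x x)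
    rw [sub_add_sub_cancel] at this
    unfold U
    linarith
  rw [abs_sub_comm, mul_comm 0.234 D, mul_assoc]
  refine total.trans (mul_le_mul_of_nonneg_left ?_ hD)
  rw [U_gauge hx, U_gauge hy, gauge_sub hx hy]
  -- Both denominators are at least 6, and 5 * (5 - 2G) / 36 < 0.2453.
  have a1 : 5 * (5 - 2 * G) / ((2 + x) * (3 - x)) - 5 * (5 - 2 * G) / ((2 + y) * (3 - y)) ≤
      0.2453 * (1 - x - y) * (y - x) := by
    have p1 : 6 ≤ (2 + x) * (3 - x) := by nlinarith
    have p2 : 6 ≤ (2 + y) * (3 - y) := by nlinarith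
    have p3 : 36 ≤ (2 + x) * (3 - x) * ((2 + y) * (3 - y)) := by nlinarith
    rw [div_sub_div _ _ (by linarith) (by linarith), div_le_iff₀ (by linarith)]
    have p4 : 0 ≤ (1 - x - y) * (y - x) := mul_nonneg (by linarith) (by linarith)
    have p5 := mul_le_mul_of_nonneg_left p3 p4
    nlinarith
  -- By AM-GM the right side is at least `(1 + w/2)⁻²` with `w = x + y`; the left side is the
  -- tangent line of this convex function at `w = 1`.
  have a2 : 4 / 9 + 8 / 27 * (1 - x - y) ≤ 1 / ((1 + x) * (1 + y)) := by
    rw [le_div_iff₀ (by positivity)]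
    have q1 : (1 + x) * (1 + y) ≤ (1 + (x + y) / 2) ^ 2 := by nlinarith [sq_nonneg (x - y)]
    have q2 := mul_le_mul_of_nonneg_left q1
      (show 0 ≤ 4 / 9 + 8 / 27 * (1 - x - y) by linarith)
    refine q2.trans ?_
    generalize hw : x + y = w at *
    have w0 : 0 ≤ w := by linarith
    have w1 : w ≤ 1 := by linarith
    rw [show 1 - x - y = 1 - w by linarith]
    nlinarith [mul_nonneg (mul_self_nonneg (w - 1)) w0, mul_self_nonneg (w - 1)]
  have a3 : 2.236 * (4 / 9 + 8 / 27 * (1 - x - y)) ≤ (2 * G - 1) / ((1 + x) * (1 + y)) := by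
    rw [div_eq_mul_one_div (2 * G - 1)]
    exact mul_le_mul (by linarith) a2 (by linarith) (by linarith)
  have a4 : (y - x) * (0.2453 * (1 - x - y) + 0.3426) ≤
      (y - x) * (0.234 * (1 + (2 * G - 1) / ((1 + x) * (1 + y)))) :=
    mul_le_mul_of_nonneg_left (by linarith) (by linarith)
  linarith

/-! ### Change of variables for the even map -/

theorem measurable_Te : Measurable Te := by
  unfold Te
  refine Measurable.ite (measurableSet_eq) measurable_const ?_
  exact (measurable_const.div measurable_id.abs).sub
    (measurable_from_top.comp ((measurable_const.div measurable_id.abs).add_const _).floor)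

theorem measurable_To : Measurable To := by
  unfold To
  refine Measurable.ite (measurableSet_eq) measurable_const ?_
  exact (measurable_const.div measurable_id).sub
    (measurable_from_top.comp ((measurable_const.div measurable_id).add_const _).floor)

/-- The range of `Te` on its `k`-th branch, the `y > 0` with `⌊1 / y + 1 / 2⌋ = k + 2`. -/
def branchRange (k : ℕ) : Set ℝ := if k = 0 then Ico 0 (1 / 2) else Ico (-(1 / 2)) (1 / 2)

/-- The contribution of the `k`-th branch to the transfer operators. -/
noncomputable def branchTerm (F : ℝ → ℝ≥0∞) (k : ℕ) (x : ℝ) : ℝ≥0∞ :=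
  ENNReal.ofReal (1 / ((k : ℝ) + 2 + x) ^ 2) * F (1 / (k + 2 + x))

/-- The transfer operator of the restriction of `Te` to `I`. -/
noncomputable def transferTe (F : ℝ → ℝ≥0∞) (x : ℝ) : ℝ≥0∞ :=
  ∑' k, (branchRange k).indicator (branchTerm F k) x

/-- The transfer operator of `T`. -/
noncomputable def transferT (F : ℝ → ℝ≥0∞) (x : ℝ) : ℝ≥0∞ :=
  ∑' k, (branchTerm F k x + branchTerm F (k + 1) (-x))

theorem branchRange_subset (k : ℕ) : branchRange k ⊆ Ico (-(1 / 2)) (1 / 2) := by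
  unfold branchRange
  split_ifs
  · exact Ico_subset_Ico_left (by norm_num)
  · exact Subset.rfl

theorem measurableSet_branchRange (k : ℕ) : MeasurableSet (branchRange k) := by
  unfold branchRange
  split_ifs <;> exact measurableSet_Ico

theorem measurable_branchTerm {F : ℝ → ℝ≥0∞} (hF : Measurable F) (k : ℕ) :
    Measurable (branchTerm F k) := by
  unfold branchTerm
  have h : Measurable fun x : ℝ => 1 / ((k : ℝ) + 2 + x) := by fun_prop
  exact (by fun_prop : Measurable fun x : ℝ => ENNReal.ofReal (1 / ((k : ℝ) + 2 + x) ^ 2)).mul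
    (hF.comp h)

theorem measurable_transferT {F : ℝ → ℝ≥0∞} (hF : Measurable F) : Measurable (transferT F) :=
  Measurable.tsum fun k =>
    (measurable_branchTerm hF k).add ((measurable_branchTerm hF (k + 1)).comp measurable_neg)

theorem measurable_transferTe {F : ℝ → ℝ≥0∞} (hF : Measurable F) : Measurable (transferTe F) :=
  Measurable.tsum fun k =>
    (measurable_branchTerm hF k).indicator (measurableSet_branchRange k)

theorem branch_pos {k : ℕ} {x : ℝ} (hx : x ∈ branchRange k) : 2 ≤ (k : ℝ) + 2 + x := by
  unfold branchRange at hx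
  split_ifs at hx with h
  · simpa [h] using hx.1
  · have : (1 : ℝ) ≤ k := by exact_mod_cast Nat.one_le_iff_ne_zero.2 h
    linarith [hx.1]

theorem floor_branch {k : ℕ} {x : ℝ} (hx : x ∈ branchRange k) :
    ⌊1 / (1 / ((k : ℝ) + 2 + x)) + 1 / 2⌋ = (k : ℤ) + 2 := by
  have h := branchRange_subset k hx
  rw [one_div_one_div, Int.floor_eq_iff]
  push_cast
  constructor <;> linarith [h.1, h.2]

theorem Te_branch {k : ℕ} {x : ℝ} (hx : x ∈ branchRange k) : Te (1 / ((k : ℝ) + 2 + x)) = x := by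
  have h := branch_pos hx
  have hp : 0 < 1 / ((k : ℝ) + 2 + x) := one_div_pos.2 (by linarith)
  rw [Te, if_neg hp.ne', abs_of_pos hp, floor_branch hx, one_div_one_div]
  push_cast
  ring

theorem iUnion_image_branch (E : Set ℝ) :
    ⋃ k : ℕ, (fun x : ℝ => 1 / ((k : ℝ) + 2 + x)) '' (branchRange k ∩ E) =
      Ioc 0 (1 / 2) ∩ Te ⁻¹' E := by
  ext y
  simp only [mem_iUnion, mem_image, mem_inter_iff, mem_preimage]
  constructor
  · rintro ⟨k, x, ⟨hx, hE⟩, rfl⟩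
    have h := branch_pos hx
    exact ⟨⟨one_div_pos.2 (by linarith), one_div_le_one_div_of_le (by norm_num) h⟩,
      by rwa [Te_branch hx]⟩
  · rintro ⟨⟨hy0, hy1⟩, hE⟩
    have h2 : 2 ≤ 1 / y := by
      rw [le_div_iff₀ hy0]
      linarith
    have hf : (2 : ℤ) ≤ ⌊1 / y + 1 / 2⌋ := Int.le_floor.2 (by push_cast; linarith)
    obtain ⟨k, hk⟩ := Int.eq_ofNat_of_zero_le (sub_nonneg.2 hf)
    have hk' : (⌊1 / y + 1 / 2⌋ : ℝ) = k + 2 := by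
      have : ⌊1 / y + 1 / 2⌋ = (k : ℤ) + 2 := by omega
      rw [this]
      push_cast
      rfl
    have hT : Te y = 1 / y - (k + 2) := by rw [Te, if_neg hy0.ne', abs_of_pos hy0, hk']
    have f1 := Int.floor_le (1 / y + 1 / 2)
    have f2 := Int.lt_floor_add_one (1 / y + 1 / 2)
    rw [hk'] at f1 f2
    refine ⟨k, Te y, ⟨?_, hE⟩, ?_⟩
    · unfold branchRange
      rw [hT]
      split_ifs with h0
      · subst h0
        simp only [Nat.cast_zero] at *
        constructor <;> linarith
      · constructor <;> linarith
    · rw [hT, add_sub_cancel, one_div_one_div]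

theorem setLIntegral_preimage_Te {F : ℝ → ℝ≥0∞} (hF : Measurable F) {E : Set ℝ}
    (hE : MeasurableSet E) : ∫⁻ y in I ∩ Te ⁻¹' E, F y = ∫⁻ x in E, transferTe F x := by
  have hJ : ∀ k, MeasurableSet (branchRange k ∩ E) := fun k => (measurableSet_branchRange k).inter hE
  have hinj : ∀ k : ℕ, InjOn (fun x : ℝ => 1 / ((k : ℝ) + 2 + x)) (branchRange k ∩ E) := by
    intro k x hx y hy hxy
    rw [← Te_branch hx.1, ← Te_branch hy.1]
    exact congrArg Te hxy
  have hder : ∀ k : ℕ, ∀ x ∈ branchRange k ∩ E,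
      HasDerivWithinAt (fun x : ℝ => 1 / ((k : ℝ) + 2 + x)) (-1 / ((k : ℝ) + 2 + x) ^ 2)
        (branchRange k ∩ E) x := by
    intro k x hx
    have h := branch_pos hx.1
    have := ((hasDerivAt_id' x).const_add ((k : ℝ) + 2)).fun_inv (by linarith)
    simpa only [one_div] using this.hasDerivWithinAt
  have hdisj : Pairwise (Function.onFun Disjoint fun k : ℕ =>
      (fun x : ℝ => 1 / ((k : ℝ) + 2 + x)) '' (branchRange k ∩ E)) := by
    intro k l hkl
    refine Set.disjoint_left.2 ?_
    rintro _ ⟨x, hx, rfl⟩ ⟨y, hy, hxy⟩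
    have h1 := floor_branch hx.1
    have h2 := floor_branch hy.1
    simp only at hxy
    rw [hxy, h1] at h2
    omega
  have hmeas : ∀ k : ℕ, MeasurableSet
      ((fun x : ℝ => 1 / ((k : ℝ) + 2 + x)) '' (branchRange k ∩ E)) := fun k =>
    (hJ k).image_of_continuousOn_injOn (fun x hx => (hder k x hx).continuousWithinAt) (hinj k)
  have hae : (I ∩ Te ⁻¹' E : Set ℝ) =ᵐ[volume] (Ioc 0 (1 / 2) ∩ Te ⁻¹' E : Set ℝ) :=
    Ioc_ae_eq_Icc.symm.inter (Filter.EventuallyEq.refl _ _)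
  rw [setLIntegral_congr hae, ← iUnion_image_branch, lintegral_iUnion hmeas hdisj]
  unfold transferTe
  rw [lintegral_tsum fun k => ((measurable_branchTerm hF k).indicator
    (measurableSet_branchRange k)).aemeasurable]
  refine tsum_congr fun k => ?_
  rw [lintegral_image_eq_lintegral_abs_deriv_mul (hJ k) (hder k) (hinj k),
    lintegral_indicator (measurableSet_branchRange k), Measure.restrict_restrict
      (measurableSet_branchRange k)]
  refine lintegral_congr fun x => ?_
  rw [branchTerm, neg_div, abs_neg, abs_of_nonneg (by positivity)]

/-! ### Symmetry -/

theorem setLIntegral_neg (f : ℝ → ℝ≥0∞) (E : Set ℝ) :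
    ∫⁻ x in Neg.neg ⁻¹' E, f x = ∫⁻ x in E, f (-x) := by
  have h := (Measure.measurePreserving_neg (volume : Measure ℝ)).setLIntegral_comp_preimage_emb
    (MeasurableEquiv.neg ℝ).measurableEmbedding (fun x => f (-x)) E
  simpa using h

theorem setLIntegral_I₀ (f : ℝ → ℝ≥0∞) {E : Set ℝ} (hE : MeasurableSet E) :
    ∫⁻ x in I₀ ∩ E, f x = (∫⁻ x in I ∩ E, f x) + ∫⁻ x in I ∩ Neg.neg ⁻¹' E, f (-x) := by
  have h1 : (I₀ ∩ E : Set ℝ) = (I ∩ E) ∪ (Ico (-(1 / 2)) 0 ∩ E) := by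
    rw [← union_inter_distrib_right, union_comm, Ico_union_Icc_eq_Icc] <;> norm_num
  have h2 : (Ico (-(1 / 2)) 0 ∩ E : Set ℝ) =ᵐ[volume] (Icc (-(1 / 2)) 0 ∩ E : Set ℝ) :=
    Ico_ae_eq_Icc.inter (Filter.EventuallyEq.refl _ _)
  have h3 : (Icc (-(1 / 2)) 0 ∩ E : Set ℝ) = Neg.neg ⁻¹' (I ∩ Neg.neg ⁻¹' E) := by
    ext x
    simp only [mem_inter_iff, mem_Icc, mem_preimage, neg_neg]
    constructor <;> rintro ⟨⟨a, b⟩, c⟩ <;> exact ⟨⟨by linarith, by linarith⟩, c⟩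
  rw [h1, lintegral_union (measurableSet_Ico.inter hE), setLIntegral_congr h2, h3,
    setLIntegral_neg]
  refine Set.disjoint_left.2 fun x hx hx' => ?_
  linarith [hx.1.1, hx'.1.2]

/-- Integrals of even functions over even sets. -/
theorem setLIntegral_abs (f : ℝ → ℝ≥0∞) {E : Set ℝ} (hE : MeasurableSet E)
    (hsymm : ∀ x, -x ∈ E ↔ x ∈ E) :
    ∫⁻ x in I₀ ∩ E, f |x| = 2 * ∫⁻ x in I ∩ E, f x := by
  have h : Neg.neg ⁻¹' E = E := Set.ext hsymm
  rw [setLIntegral_I₀ _ hE, h, two_mul]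
  simp_rw [abs_neg]
  have : ∫⁻ x in I ∩ E, f |x| = ∫⁻ x in I ∩ E, f x :=
    setLIntegral_congr_fun (measurableSet_Icc.inter hE) fun x hx => by
      simp only [abs_of_nonneg hx.1.1]
  rw [this]

/-- For `0 < x < 1/2` the point `x` receives all branches of `Te` and `-x` only those with `k ≥ 1`;
these are the plus and minus branches of `T` over `x`. -/
theorem transferTe_add_neg (F : ℝ → ℝ≥0∞) {x : ℝ} (h0 : x ≠ 0) (h1 : |x| ≠ 1 / 2) :
    transferTe F x + transferTe F (-x) = I₀.indicator (fun x => transferT F |x|) x := by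
  wlog hx : 0 < x generalizing x
  · have := this (x := -x) (neg_ne_zero.2 h0) (by rwa [abs_neg])
      (neg_pos.2 (lt_of_le_of_ne (not_lt.1 hx) h0))
    rw [neg_neg, add_comm] at this
    rw [this]
    simp only [indicator, abs_neg, mem_Icc]
    refine if_congr ?_ rfl rfl
    constructor <;> rintro ⟨a, b⟩ <;> constructor <;> linarith
  rw [abs_of_pos hx] at h1
  by_cases hlt : x < 1 / 2
  · have hmem : x ∈ I₀ := ⟨by linarith, hlt.le⟩
    rw [indicator_of_mem hmem, abs_of_pos hx]
    unfold transferTe transferT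
    rw [ENNReal.tsum_add]
    congr 1
    · refine tsum_congr fun k => indicator_of_mem ?_ _
      unfold branchRange
      split_ifs
      · exact ⟨hx.le, hlt⟩
      · exact ⟨by linarith, hlt⟩
    · rw [tsum_eq_zero_add' ENNReal.summable, indicator_of_notMem, zero_add]
      · refine tsum_congr fun k => indicator_of_mem ?_ _
        rw [branchRange, if_neg k.succ_ne_zero]
        constructor <;> linarith
      · rw [branchRange, if_pos rfl]
        rintro ⟨h, _⟩
        linarith
  · have hgt : 1 / 2 < x := lt_of_le_of_ne (not_lt.1 hlt) (Ne.symm h1)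
    rw [indicator_of_notMem fun h : x ∈ I₀ => by linarith [h.2]]
    unfold transferTe
    have e1 : ∀ k, (branchRange k).indicator (branchTerm F k) x = 0 := fun k =>
      indicator_of_notMem (fun h => by linarith [(branchRange_subset k h).2]) _
    have e2 : ∀ k, (branchRange k).indicator (branchTerm F k) (-x) = 0 := fun k =>
      indicator_of_notMem (fun h => by linarith [(branchRange_subset k h).1]) _
    simp [e1, e2]

/-- Oddness of rounding to the nearest integer fails only at ties, that is when `1 / x` is a
half-integer. -/
theorem To_neg_ae : ∀ᵐ x : ℝ, 0 < x → To (-x) = -Te x := by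
  have hc : (range fun n : ℤ => 1 / ((n : ℝ) - 1 / 2)).Countable := countable_range _
  filter_upwards [hc.ae_notMem volume] with x hx hpos
  have hx0 : x ≠ 0 := hpos.ne'
  rw [To, Te, if_neg hx0, if_neg (neg_ne_zero.2 hx0), abs_of_pos hpos, one_div_neg_eq_neg_one_div]
  have f1 := Int.floor_le (1 / x + 1 / 2)
  have f2 := Int.lt_floor_add_one (1 / x + 1 / 2)
  have f3 : (⌊1 / x + 1 / 2⌋ : ℝ) ≠ 1 / x + 1 / 2 := by
    intro h
    refine hx ⟨⌊1 / x + 1 / 2⌋, ?_⟩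
    simp only [h, add_sub_cancel_right, one_div_one_div]
  have f4 := lt_of_le_of_ne f1 f3
  have : ⌊-(1 / x) + 1 / 2⌋ = -⌊1 / x + 1 / 2⌋ := by
    rw [Int.floor_eq_iff]
    push_cast
    constructor <;> linarith
  rw [this]
  push_cast
  ring

theorem To_of_pos {x : ℝ} (hx : 0 < x) : To x = Te x := by
  rw [To, Te, abs_of_pos hx]

/-- The density of the image under `To` of a symmetric measure on `I₀`. -/
theorem setLIntegral_preimage_To {F : ℝ → ℝ≥0∞} (hF : Measurable F) {E : Set ℝ}
    (hE : MeasurableSet E) :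
    ∫⁻ x in I₀ ∩ To ⁻¹' E, F |x| = ∫⁻ x in I₀ ∩ E, transferT F |x| := by
  have hpos : ∀ᵐ x : ℝ, x ≠ 0 := by
    simpa using (countable_singleton (0 : ℝ)).ae_notMem volume
  have hhalf : ∀ᵐ x : ℝ, |x| ≠ 1 / 2 := by
    filter_upwards [((countable_singleton (-(1 / 2) : ℝ)).insert (1 / 2)).ae_notMem volume]
      with x hx h
    rcases (abs_eq (by norm_num)).1 h with h | h <;> simp [h] at hx
  have e1 : (I ∩ To ⁻¹' E : Set ℝ) =ᵐ[volume] (I ∩ Te ⁻¹' E : Set ℝ) := by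
    filter_upwards [hpos] with x hx
    refine propext (and_congr_right fun h => ?_)
    rw [mem_preimage, mem_preimage, To_of_pos (lt_of_le_of_ne h.1 (Ne.symm hx))]
  have e2 : (I ∩ Neg.neg ⁻¹' (To ⁻¹' E) : Set ℝ) =ᵐ[volume]
      (I ∩ Te ⁻¹' (Neg.neg ⁻¹' E) : Set ℝ) := by
    filter_upwards [hpos, To_neg_ae] with x hx hx'
    refine propext (and_congr_right fun h => ?_)
    simp only [mem_preimage]
    rw [hx' (lt_of_le_of_ne h.1 (Ne.symm hx))]
  have habs : ∀ {A : Set ℝ}, MeasurableSet A → ∫⁻ x in I ∩ A, F |x| = ∫⁻ x in I ∩ A, F x :=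
    fun hA => setLIntegral_congr_fun (measurableSet_Icc.inter hA) fun x hx => by
      simp only [abs_of_nonneg hx.1.1]
  rw [setLIntegral_I₀ _ (measurable_To hE), setLIntegral_congr e1, setLIntegral_congr e2]
  simp_rw [abs_neg]
  rw [habs (measurable_Te hE), habs (measurable_Te (measurable_neg hE)),
    setLIntegral_preimage_Te hF hE, setLIntegral_preimage_Te hF (measurable_neg hE),
    setLIntegral_neg _ E, ← lintegral_add_left (measurable_transferTe hF),
    ← Measure.restrict_restrict measurableSet_Icc, ← lintegral_indicator measurableSet_Icc]
  refine lintegral_congr_ae (ae_restrict_of_ae ?_)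
  filter_upwards [hpos, hhalf] with x h0 h1
  exact transferTe_add_neg F h0 h1

/-- The density at time `n` of the orbit of a uniform point. -/
noncomputable def iterDensity (n : ℕ) : ℝ → ℝ≥0∞ := transferT^[n] fun _ => 1

theorem iterDensity_succ (n : ℕ) : iterDensity (n + 1) = transferT (iterDensity n) :=
  Function.iterate_succ_apply' _ _ _

theorem measurable_iterDensity (n : ℕ) : Measurable (iterDensity n) := by
  induction n with
  | zero => exact measurable_const
  | succ n ih => rw [iterDensity_succ]; exact measurable_transferT ih

theorem volume_preimage_iterate_To (n : ℕ) {E : Set ℝ} (hE : MeasurableSet E) :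
    volume (I₀ ∩ To^[n] ⁻¹' E) = ∫⁻ x in I₀ ∩ E, iterDensity n |x| := by
  induction n generalizing E with
  | zero => simp [iterDensity]
  | succ n ih =>
    rw [Function.iterate_succ', preimage_comp, ih (measurable_To hE), iterDensity_succ]
    exact setLIntegral_preimage_To (measurable_iterDensity n) hE

/-! ### The invariant densities -/

theorem log_golden_pos : 0 < Real.log G := Real.log_pos Real.one_lt_goldenRatio

theorem density_eq {x : ℝ} (hx : x ∈ I) : density x = 1 / (Real.log G * invH x) := by
  have hg := golden_bounds
  have e1 : G + x ≠ 0 := by linarith [hx.1]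
  have e2 : G + 1 - x ≠ 0 := by linarith [hx.2]
  rw [density, invH, one_div_add_one_div e1 e2, show G + x + (G + 1 - x) = 2 * G + 1 by ring]
  generalize Real.log G = l
  rw [← one_div_mul_one_div, one_div_div]

theorem density_pos {x : ℝ} (hx : x ∈ I) : 0 < density x := by
  rw [density_eq hx]
  exact one_div_pos.2 (mul_pos log_golden_pos (invH_pos hx))

theorem measurable_density : Measurable density := by
  unfold density
  fun_prop

theorem densityO_eq (x : ℝ) : densityO x = density |x| / 2 := by
  unfold densityO density
  rw [← one_div_mul_one_div]
  ring

theorem invH_mul_density {x : ℝ} (hx : x ∈ I) : invH x * density x = 1 / Real.log G := by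
  have h := (invH_pos hx).ne'
  rw [density_eq hx, ← one_div_mul_one_div, mul_left_comm, mul_one_div_cancel h, mul_one]

/-- Since `G + 1 = G^2`, the left side is `G^3 / ((G m + 1) (G^2 m - 1))` up to the factor `1 / log
G`; now use `1 / G = G - 1` and `1 / G^2 = 2 - G`. -/
theorem density_one_div {m : ℝ} (hm : 2 ≤ m) :
    1 / m ^ 2 * density (1 / m) = 1 / Real.log G * (1 / (m + G - 2) - 1 / (m + G - 1)) := by
  have hg := golden_bounds
  have hq := Real.goldenRatio_sq
  have h1 : m ≠ 0 := by linarith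
  have h2 : G * m + 1 ≠ 0 := by nlinarith
  have h3 : (G + 1) * m - 1 ≠ 0 := by nlinarith
  have h4 : m + G - 2 ≠ 0 := by linarith
  have h5 : m + G - 1 ≠ 0 := by linarith
  have e1 : G + 1 / m = (G * m + 1) / m := by rw [add_div, mul_div_cancel_right₀ _ h1]
  have e2 : G + 1 - 1 / m = ((G + 1) * m - 1) / m := by rw [sub_div, mul_div_cancel_right₀ _ h1]
  rw [density, e1, e2, one_div_div, one_div_div]
  generalize Real.log G = l
  rw [mul_left_comm]
  congr 1
  generalize G = g at *
  rw [div_add_div _ _ h2 h3, div_sub_div _ _ h4 h5, div_mul_div_comm,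
    div_eq_div_iff (mul_ne_zero (pow_ne_zero 2 h1) (mul_ne_zero h2 h3)) (mul_ne_zero h4 h5)]
  linear_combination (2 * g * m ^ 2 + m ^ 2 - (m ^ 4 - 4 * m ^ 3 + 4 * m ^ 2)) * hq

theorem branchTerm_density (γ : ℝ → ℝ) (k : ℕ) {x : ℝ} (hx : 2 ≤ (k : ℝ) + 2 + x) :
    branchTerm (fun y => ENNReal.ofReal (γ y * density y)) k x =
      ENNReal.ofReal (1 / Real.log G * tel k (G + x) * γ (1 / (k + 2 + x))) := by
  rw [branchTerm, ← ENNReal.ofReal_mul (by positivity), mul_left_comm, density_one_div hx, tel,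
    show (k : ℝ) + 2 + x + G - 2 = k + (G + x) by ring,
    show (k : ℝ) + 2 + x + G - 1 = k + 1 + (G + x) by ring, mul_comm]

theorem branchTerm_congr {F F' : ℝ → ℝ≥0∞} (h : ∀ x ∈ I, F x = F' x) (k : ℕ) {x : ℝ}
    (hx : 2 ≤ (k : ℝ) + 2 + x) : branchTerm F k x = branchTerm F' k x := by
  rw [branchTerm, branchTerm, h]
  exact ⟨one_div_nonneg.2 (by linarith), one_div_le_one_div_of_le (by norm_num) hx⟩

theorem tel_succ (k : ℕ) (c : ℝ) : tel (k + 1) c = tel k (1 + c) := by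
  unfold tel
  push_cast
  rw [add_assoc (k : ℝ) 1 c, show (k : ℝ) + 1 + 1 + c = k + 1 + (1 + c) by ring]

/-- `transferT` is `U` after normalization by the invariant density. -/
theorem transferT_density {γ : ℝ → ℝ} {B x : ℝ} (hγ : ∀ s ∈ I, 0 ≤ γ s) (hB : ∀ s ∈ I, |γ s| ≤ B)
    {F : ℝ → ℝ≥0∞} (hF : ∀ s ∈ I, F s = ENNReal.ofReal (γ s * density s)) (hx : x ∈ I) :
    0 ≤ U γ x ∧ transferT F x = ENNReal.ofReal (U γ x * density x) := by
  have hg := golden_bounds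
  have hp := fun k => mul_nonneg (cP_nonneg k hx) (hγ _ (one_div_add_mem k hx))
  have hm := fun k => mul_nonneg (cM_nonneg k hx) (hγ _ (one_div_sub_mem k hx))
  refine ⟨tsum_nonneg fun k => add_nonneg (hp k) (hm k), ?_⟩
  have hd := (density_pos hx).le
  rw [transferT, U, avg, ← tsum_mul_right, ENNReal.ofReal_tsum_of_nonneg
    (fun k => mul_nonneg (add_nonneg (hp k) (hm k)) hd) ((summable_avg hB hx hx).mul_right _)]
  refine tsum_congr fun k => ?_
  have hk : (0 : ℝ) ≤ k := k.cast_nonneg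
  rw [branchTerm_congr hF k (by linarith [hx.1]),
    branchTerm_congr hF (k + 1) (by push_cast; linarith [hx.2]), branchTerm_density _ _
      (by linarith [hx.1]), branchTerm_density _ _ (by push_cast; linarith [hx.2]), add_mul,
    ENNReal.ofReal_add (mul_nonneg (hp k) hd) (mul_nonneg (hm k) hd), ← invH_mul_density hx,
    tel_succ, cP, cM]
  push_cast
  rw [show 1 + (G + -x) = G + 1 - x by ring, show (k : ℝ) + 1 + 2 + -x = k + 3 - x by ring]
  congr 2 <;> ring

/-- The branches telescope: from `k = 0` when `x ≥ 0`, from `k = 1` when `x < 0`. Hence the two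
formulas in `densityE`. -/
theorem transferTe_density {x : ℝ} (hx : x ∈ Ico (-(1 / 2) : ℝ) (1 / 2)) :
    transferTe (fun y => ENNReal.ofReal (density y)) x = ENNReal.ofReal (densityE x) := by
  have hg := golden_bounds
  have hl := log_golden_pos
  obtain ⟨hx0, hx1⟩ := hx
  have hterm : ∀ k : ℕ, 2 ≤ (k : ℝ) + 2 + x →
      branchTerm (fun y => ENNReal.ofReal (density y)) k x =
        ENNReal.ofReal (1 / Real.log G * tel k (G + x)) := fun k hk => by
    simpa using branchTerm_density (fun _ => 1) k hk
  have hsum : ∀ c : ℝ, 0 < c → ∑' k, ENNReal.ofReal (1 / Real.log G * tel k c) =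
      ENNReal.ofReal (1 / Real.log G * (1 / c)) := fun c hc => by
    have h := (hasSum_tel hc).mul_left (1 / Real.log G)
    rw [← h.tsum_eq, ENNReal.ofReal_tsum_of_nonneg
      (fun k => mul_nonneg (one_div_pos.2 hl).le (tel_nonneg k hc)) h.summable]
  by_cases h : 0 ≤ x
  · rw [densityE, if_pos h, ← hsum _ (by linarith), transferTe]
    refine tsum_congr fun k => ?_
    rw [indicator_of_mem, hterm k]
    · linarith [k.cast_nonneg (α := ℝ)]
    · unfold branchRange
      split_ifs
      · exact ⟨h, hx1⟩
      · exact ⟨hx0, hx1⟩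
  · rw [densityE, if_neg h, show G + x + 1 = 1 + (G + x) by ring,
      ← hsum _ (by linarith), transferTe, tsum_eq_zero_add' ENNReal.summable, indicator_of_notMem,
      zero_add]
    · refine tsum_congr fun k => ?_
      rw [indicator_of_mem, hterm, tel_succ]
      · push_cast
        linarith [k.cast_nonneg (α := ℝ)]
      · rw [branchRange, if_neg k.succ_ne_zero]
        exact ⟨hx0, hx1⟩
    · rw [branchRange, if_pos rfl]
      exact fun h' => h h'.1

theorem lintegral_density : ∫⁻ x in I, ENNReal.ofReal (density x) = 1 := by
  have hg := golden_bounds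
  have hder : ∀ x ∈ uIcc (0 : ℝ) (1 / 2), HasDerivAt
      (fun x => 1 / Real.log G * (Real.log (G + x) - Real.log (G + 1 - x))) (density x) x := by
    intro x hx
    rw [uIcc_of_le (by norm_num)] at hx
    have h1 := ((hasDerivAt_id' x).const_add G).log (by linarith [hx.1])
    have h2 := ((hasDerivAt_id' x).const_sub (G + 1)).log (by linarith [hx.2])
    have h3 := (h1.sub h2).const_mul (1 / Real.log G)
    rw [neg_div, sub_neg_eq_add] at h3
    exact h3
  have hcont : ContinuousOn density (Icc 0 (1 / 2)) := by
    unfold density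
    refine continuousOn_const.mul (ContinuousOn.add ?_ ?_) <;>
      refine continuousOn_const.div (by fun_prop) fun x hx => ?_ <;> linarith [hx.1, hx.2]
  have hint : IntervalIntegrable density volume 0 (1 / 2) :=
    ContinuousOn.intervalIntegrable (by rwa [uIcc_of_le (by norm_num)])
  have hI := intervalIntegral.integral_eq_sub_of_hasDerivAt hder hint
  rw [intervalIntegral.integral_of_le (by norm_num), ← integral_Icc_eq_integral_Ioc] at hI
  have hl := log_golden_pos.ne'
  rw [← ofReal_integral_eq_lintegral_ofReal hcont.integrableOn_Icc
    ((ae_restrict_iff' measurableSet_Icc).2 (ae_of_all _ fun x hx => (density_pos hx).le)), hI,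
    add_zero, sub_zero, show G + 1 - 1 / 2 = G + 1 / 2 by ring, ← Real.goldenRatio_sq,
    Real.log_pow, sub_self]
  rw [← ENNReal.ofReal_one]
  congr 1
  generalize Real.log G = l at *
  push_cast
  field_simp
  ring

theorem μ_apply {E : Set ℝ} (hE : MeasurableSet E) :
    μ E = ∫⁻ x in I ∩ E, ENNReal.ofReal (density x) := by
  rw [μ, withDensity_apply _ hE, Measure.restrict_restrict hE, inter_comm]

theorem μo_apply {E : Set ℝ} (hE : MeasurableSet E) :
    μo E = ∫⁻ x in I₀ ∩ E, ENNReal.ofReal (densityO x) := by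
  rw [μo, withDensity_apply _ hE, Measure.restrict_restrict hE, inter_comm]

theorem μo_apply_of_symm {E : Set ℝ} (hE : MeasurableSet E) (hsymm : ∀ x, -x ∈ E ↔ x ∈ E) :
    μo E = ∫⁻ x in I ∩ E, ENNReal.ofReal (density x) := by
  have h2 : ∀ y : ℝ, ENNReal.ofReal (density y) = 2 * ENNReal.ofReal (density y / 2) := fun y => by
    rw [show (2 : ℝ≥0∞) = ENNReal.ofReal 2 by simp, ← ENNReal.ofReal_mul (by norm_num)]
    congr 1
    ring
  rw [μo_apply hE]
  simp_rw [densityO_eq, h2]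
  rw [setLIntegral_abs (fun y => ENNReal.ofReal (density y / 2)) hE hsymm, lintegral_const_mul]
  exact (measurable_density.div_const 2).ennreal_ofReal

theorem μo_univ : μo univ = 1 := by
  rw [μo_apply_of_symm MeasurableSet.univ (by simp), inter_univ, lintegral_density]

theorem μo_preimage_Te {E : Set ℝ} (hE : MeasurableSet E) (hsub : E ⊆ I₀) :
    μo (Te ⁻¹' E) = μe E := by
  have hneg : ∀ x, Te (-x) = Te x := fun x => by simp [Te]
  have h1 : (I₀ ∩ E : Set ℝ) = E := inter_eq_right.2 hsub
  have h2 : (E : Set ℝ) =ᵐ[volume] (Ico (-(1 / 2)) (1 / 2) ∩ E : Set ℝ) := by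
    conv_lhs => rw [← h1]
    exact Ico_ae_eq_Icc.symm.inter (Filter.EventuallyEq.refl _ _)
  rw [μo_apply_of_symm (measurable_Te hE) (by simp [hneg]),
    setLIntegral_preimage_Te measurable_density.ennreal_ofReal hE, μe, withDensity_apply _ hE,
    Measure.restrict_restrict hE, inter_comm, h1, setLIntegral_congr h2, setLIntegral_congr h2]
  exact setLIntegral_congr_fun (measurableSet_Ico.inter hE) fun x hx => transferTe_density hx.1

/-! ### Convergence of the densities -/

/-- The uniform density 1 corresponds to `γ = log G * invH`, and each step applies `U`. -/
theorem exists_iterDensity_eq (n : ℕ) : ∃ γ : ℝ → ℝ, (∀ s ∈ I, 0 ≤ γ s) ∧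
    GaugeLip (0.234 ^ n * Real.log G) γ ∧
    ∀ s ∈ I, iterDensity n s = ENNReal.ofReal (γ s * density s) := by
  have hl := log_golden_pos
  have hg := golden_bounds
  induction n with
  | zero =>
    refine ⟨fun s => Real.log G * invH s, fun s hs => (mul_pos hl (invH_pos hs)).le,
      fun s hs t ht hst => ?_, fun s hs => ?_⟩
    · rw [pow_zero, one_mul, ← mul_sub, abs_mul, abs_of_pos hl]
      refine mul_le_mul_of_nonneg_left (le_trans ?_ (sub_le_gauge_sub hs ht hst)) hl.le
      have e : invH s - invH t = (t - s) * ((s + t - 1) / (2 * G + 1)) := by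
        unfold invH
        generalize 2 * G + 1 = c
        ring
      rw [e, abs_mul, abs_of_nonneg (sub_nonneg.2 hst)]
      refine mul_le_of_le_one_right (sub_nonneg.2 hst) ?_
      rw [abs_div, abs_of_pos (show 0 < 2 * G + 1 by linarith), div_le_one (by linarith), abs_le]
      constructor <;> linarith [hs.1, hs.2, ht.1, ht.2]
    · rw [density_eq hs, mul_one_div_cancel (mul_pos hl (invH_pos hs)).ne', ENNReal.ofReal_one]
      rfl
  | succ n ih =>
    obtain ⟨γ, h0, hγ, hF⟩ := ih
    have hD : 0 ≤ 0.234 ^ n * Real.log G := by positivity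
    obtain ⟨B, hB⟩ := hγ.bounded hD
    refine ⟨U γ, fun s hs => (transferT_density h0 hB hF hs).1, ?_, fun s hs => ?_⟩
    · rw [pow_succ', mul_assoc]
      exact hγ.map_U hD
    · rw [iterDensity_succ]
      exact (transferT_density h0 hB hF hs).2

/-- A normalized density of small oscillation is close to its mean. -/
theorem abs_sub_one_le_of_osc {γ : ℝ → ℝ} {ε : ℝ} (hosc : ∀ s ∈ I, ∀ t ∈ I, |γ s - γ t| ≤ ε)
    (hint : 2 * ∫⁻ x in I, ENNReal.ofReal (γ x * density x) = 1) {s : ℝ} (hs : s ∈ I) :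
    |2 * γ s - 1| ≤ 2 * ε := by
  have hd : ∀ a : ℝ, 2 * ∫⁻ x in I, ENNReal.ofReal a * ENNReal.ofReal (density x) =
      ENNReal.ofReal (2 * a) := fun a => by
    rw [lintegral_const_mul _ measurable_density.ennreal_ofReal, lintegral_density, mul_one,
      ENNReal.ofReal_mul zero_le_two]
    simp
  have lower : ENNReal.ofReal (2 * (γ s - ε)) ≤ 1 := by
    rw [← hint, ← hd]
    refine mul_le_mul_right (setLIntegral_mono' measurableSet_Icc fun x hx => ?_) _
    rw [← ENNReal.ofReal_mul' (density_pos hx).le]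
    refine ENNReal.ofReal_le_ofReal (mul_le_mul_of_nonneg_right ?_ (density_pos hx).le)
    linarith [(abs_le.1 (hosc s hs x hx)).2]
  have upper : 1 ≤ ENNReal.ofReal (2 * (γ s + ε)) := by
    rw [← hint, ← hd]
    refine mul_le_mul_right (setLIntegral_mono' measurableSet_Icc fun x hx => ?_) _
    rw [← ENNReal.ofReal_mul' (density_pos hx).le]
    refine ENNReal.ofReal_le_ofReal (mul_le_mul_of_nonneg_right ?_ (density_pos hx).le)
    linarith [(abs_le.1 (hosc s hs x hx)).1]
  rw [ENNReal.ofReal_le_one] at lower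
  rw [ENNReal.one_le_ofReal] at upper
  rw [abs_le]
  constructor <;> linarith

theorem volume_preimage_To_sub_le : ∃ C : ℝ, 0 ≤ C ∧ ∀ E : Set ℝ, MeasurableSet E → ∀ n : ℕ,
    |volume.real (I₀ ∩ To^[n] ⁻¹' E) - μo.real E| ≤ C * (μo.real E * 0.234 ^ n) := by
  have hl := log_golden_pos
  have z : (0 : ℝ) ∈ I := by constructor <;> norm_num
  have w : (1 / 2 : ℝ) ∈ I := by constructor <;> norm_num
  have hgz := antitoneOn_gauge z w w.1
  refine ⟨2 * (Real.log G * (gauge 0 - gauge (1 / 2))), mul_nonneg zero_le_two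
    (mul_nonneg hl.le (sub_nonneg.2 hgz)), fun E hE n => ?_⟩
  obtain ⟨γ, h0, hγ, hF⟩ := exists_iterDensity_eq n
  set D := 0.234 ^ n * Real.log G with hD
  have hD0 : 0 ≤ D := by positivity
  have hosc : ∀ s ∈ I, ∀ t ∈ I, |γ s - γ t| ≤ D * (gauge 0 - gauge (1 / 2)) := by
    have : ∀ s ∈ I, ∀ t ∈ I, s ≤ t → |γ s - γ t| ≤ D * (gauge 0 - gauge (1 / 2)) := by
      intro s hs t ht hst
      refine (hγ s hs t ht hst).trans (mul_le_mul_of_nonneg_left ?_ hD0)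
      linarith [antitoneOn_gauge z hs hs.1, antitoneOn_gauge ht w ht.2]
    intro s hs t ht
    rcases le_total s t with h | h
    · exact this s hs t ht h
    · rw [abs_sub_comm]
      exact this t ht s hs h
  -- Conservation of total mass, the case `E = univ`: the mean of `γ` is 1/2.
  have hint : 2 * ∫⁻ x in I, ENNReal.ofReal (γ x * density x) = 1 := by
    have h := volume_preimage_iterate_To n MeasurableSet.univ
    rw [setLIntegral_abs _ MeasurableSet.univ (by simp), preimage_univ, inter_univ, inter_univ,
      Real.volume_Icc, setLIntegral_congr_fun measurableSet_Icc hF] at h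
    rw [← h]
    norm_num
  set δ := 2 * (D * (gauge 0 - gauge (1 / 2))) with hδ
  have hclose : ∀ s ∈ I, |2 * γ s - 1| ≤ δ := fun s hs => abs_sub_one_le_of_osc hosc hint hs
  have hδ0 : 0 ≤ δ := (abs_nonneg _).trans (hclose 0 z)
  have habs : ∀ x ∈ I₀, |x| ∈ I := fun x hx => ⟨abs_nonneg x, abs_le.2 hx⟩
  have hO : Measurable fun x => ENNReal.ofReal (densityO x) := by
    simp_rw [densityO_eq]
    exact ((measurable_density.comp measurable_id.abs).div_const 2).ennreal_ofReal
  have hval : ∀ x ∈ I₀, iterDensity n |x| = ENNReal.ofReal (2 * γ |x| * densityO x) :=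
    fun x hx => by
      rw [hF _ (habs x hx), densityO_eq]
      congr 1
      ring
  have hdO : ∀ x ∈ I₀, 0 ≤ densityO x := fun x hx => by
    rw [densityO_eq]
    exact (half_pos (density_pos (habs x hx))).le
  have upper : volume (I₀ ∩ To^[n] ⁻¹' E) ≤ ENNReal.ofReal (1 + δ) * μo E := by
    rw [volume_preimage_iterate_To n hE, μo_apply hE, ← lintegral_const_mul _ hO]
    refine setLIntegral_mono' (measurableSet_Icc.inter hE) fun x hx => ?_
    rw [hval x hx.1, ← ENNReal.ofReal_mul' (hdO x hx.1)]
    refine ENNReal.ofReal_le_ofReal (mul_le_mul_of_nonneg_right ?_ (hdO x hx.1))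
    linarith [(abs_le.1 (hclose _ (habs x hx.1))).2]
  have lower : ENNReal.ofReal (1 - δ) * μo E ≤ volume (I₀ ∩ To^[n] ⁻¹' E) := by
    rw [volume_preimage_iterate_To n hE, μo_apply hE, ← lintegral_const_mul _ hO]
    refine setLIntegral_mono' (measurableSet_Icc.inter hE) fun x hx => ?_
    rw [hval x hx.1, ← ENNReal.ofReal_mul' (hdO x hx.1)]
    refine ENNReal.ofReal_le_ofReal (mul_le_mul_of_nonneg_right ?_ (hdO x hx.1))
    linarith [(abs_le.1 (hclose _ (habs x hx.1))).1]
  have hfin : μo E ≠ ∞ := ((measure_mono (subset_univ E)).trans_lt (by simp [μo_univ])).ne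
  have hv : volume (I₀ ∩ To^[n] ⁻¹' E) ≠ ∞ :=
    ((measure_mono inter_subset_left).trans_lt (by simp)).ne
  have u := ENNReal.toReal_mono (ENNReal.mul_ne_top ENNReal.ofReal_ne_top hfin) upper
  have l := ENNReal.toReal_mono hv lower
  rw [ENNReal.toReal_mul, ENNReal.toReal_ofReal (by linarith)] at u
  rw [ENNReal.toReal_mul] at l
  have l' := (mul_le_mul_of_nonneg_right (ENNReal.toReal_ofReal' (r := 1 - δ) ▸ le_max_left _ _ :
    1 - δ ≤ (ENNReal.ofReal (1 - δ)).toReal) ENNReal.toReal_nonneg).trans l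
  have e : 2 * (Real.log G * (gauge 0 - gauge (1 / 2))) * (μo.real E * 0.234 ^ n) =
      δ * (μo E).toReal := by
    rw [hδ, hD, Measure.real]
    ring
  rw [e, Measure.real, Measure.real, abs_le]
  constructor <;> linarith

/-! ### Reduction of the other maps to the odd map -/

/-- Both sides are the distance to the nearest integer, which does not depend on how ties are
broken; hence no exceptional set here. -/
theorem abs_sub_round_abs (t : ℝ) : |(|t| - (⌊|t| + 1 / 2⌋ : ℝ))| = |t - (⌊t + 1 / 2⌋ : ℝ)| := by
  rcases abs_choice t with h | h
  · rw [h]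
  · rw [h, ← round_eq, ← round_eq, abs_sub_round_eq_min, abs_sub_round_eq_min]
    by_cases h0 : Int.fract t = 0
    · rw [Int.fract_neg_eq_zero.2 h0, h0]
    · rw [Int.fract_neg h0, sub_sub_cancel, min_comm]

theorem abs_To (x : ℝ) : |To x| = T |x| := by
  unfold To T
  by_cases h : x = 0
  · simp [h]
  · rw [if_neg h, if_neg (abs_ne_zero.2 h), ← abs_one_div, abs_sub_round_abs]

theorem abs_Te (x : ℝ) : |Te x| = T |x| := by
  unfold Te T
  by_cases h : x = 0
  · simp [h]
  · rw [if_neg h, if_neg (abs_ne_zero.2 h)]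

theorem abs_iterate {f : ℝ → ℝ} (hf : ∀ x, |f x| = T |x|) (n : ℕ) (x : ℝ) :
    |f^[n] x| = T^[n] |x| :=
  (Function.Semiconj.iterate_right (f := fun x : ℝ => |x|) hf n) x

/-- `Te` is even, so it sees only the absolute value of the previous iterate, on which `To` and `Te`
agree. -/
theorem Te_iterate_succ (n : ℕ) (x : ℝ) : Te^[n + 1] x = Te (To^[n] x) := by
  have h : ∀ y, Te y = Te |y| := fun y => by simp [Te]
  rw [Function.iterate_succ_apply', h, abs_iterate abs_Te, h (To^[n] x), abs_iterate abs_To]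

theorem volume_preimage_T (n : ℕ) {E : Set ℝ} (hE : MeasurableSet E) :
    volume (I₀ ∩ To^[n] ⁻¹' ((fun x => |x|) ⁻¹' E)) = 2 * volume (I ∩ T^[n] ⁻¹' E) := by
  have hm : MeasurableSet (To^[n] ⁻¹' ((fun x => |x|) ⁻¹' E)) :=
    (measurable_To.iterate n) (measurable_id.abs hE)
  have h := setLIntegral_abs (fun _ => 1) hm fun x => by
    simp only [mem_preimage, abs_iterate abs_To, abs_neg]
  rw [setLIntegral_one, setLIntegral_one] at h
  rw [h]
  congr 2
  ext x
  refine and_congr_right fun hx => ?_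
  simp only [mem_preimage, abs_iterate abs_To, abs_of_nonneg hx.1]

theorem μo_preimage_abs {E : Set ℝ} (hE : MeasurableSet E) : μo ((fun x => |x|) ⁻¹' E) = μ E := by
  have hm : MeasurableSet ((fun x : ℝ => |x|) ⁻¹' E) := measurable_id.abs hE
  rw [μo_apply_of_symm hm (by simp), μ_apply hE]
  congr 2
  ext x
  refine and_congr_right fun hx => ?_
  simp only [mem_preimage, abs_of_nonneg hx.1]

theorem volume_le_μe {E : Set ℝ} (hE : MeasurableSet E) (hsub : E ⊆ I₀) :
    volume E ≤ ENNReal.ofReal (Real.log G * (G + 1)) * μe E := by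
  have hg := golden_bounds
  have hl := log_golden_pos
  have hm : Measurable fun x => ENNReal.ofReal (densityE x) := by
    unfold densityE
    refine (measurable_const.mul (Measurable.ite measurableSet_Ici ?_ ?_)).ennreal_ofReal <;>
      fun_prop
  rw [μe, withDensity_apply _ hE, Measure.restrict_restrict hE, inter_eq_left.2 hsub,
    ← lintegral_const_mul _ hm, ← setLIntegral_one]
  refine setLIntegral_mono' hE fun x hx => ?_
  have hx0 := (hsub hx).1
  have hx1 := (hsub hx).2
  rw [← ENNReal.ofReal_mul (by positivity), ENNReal.one_le_ofReal, densityE]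
  have key : ∀ c : ℝ, 0 < c → c ≤ G + 1 →
      1 ≤ Real.log G * (G + 1) * (1 / Real.log G * (1 / c)) := by
    intro c hc hcG
    have : Real.log G * (G + 1) * (1 / Real.log G * (1 / c)) = (G + 1) / c := by
      generalize Real.log G = l at *
      generalize G + 1 = a
      field_simp
    rw [this, le_div_iff₀ hc]
    linarith
  split_ifs with h
  · exact key _ (by linarith) (by linarith)
  · exact key _ (by linarith) (by linarith)

end NICF

theorem theorem1 :
    (∃ C : ℝ, ∀ E : Set ℝ, MeasurableSet E → E ⊆ NICF.I → ∀ n : ℕ,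
      |volume.real (NICF.iterPreimage NICF.T NICF.I n E) - 1 / 2 * NICF.μ.real E|
        ≤ C * (NICF.μ.real E * (0.288 : ℝ) ^ n)) ∧
    (∃ C : ℝ, ∀ E : Set ℝ, MeasurableSet E → E ⊆ NICF.I₀ → ∀ n : ℕ,
      |volume.real (NICF.iterPreimage NICF.To NICF.I₀ n E) - NICF.μo.real E|
        ≤ C * (NICF.μo.real E * (0.288 : ℝ) ^ n)) ∧
    (∃ C : ℝ, ∀ E : Set ℝ, MeasurableSet E → E ⊆ NICF.I₀ → ∀ n : ℕ,
      |volume.real (NICF.iterPreimage NICF.Te NICF.I₀ n E) - NICF.μe.real E|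
        ≤ C * (NICF.μe.real E * (0.234 : ℝ) ^ n)) := by
  obtain ⟨C, hC, h⟩ := NICF.volume_preimage_To_sub_le
  have rate : ∀ n : ℕ, (0.234 : ℝ) ^ n ≤ 0.288 ^ n := fun n =>
    pow_le_pow_left₀ (by norm_num) (by norm_num) n
  -- In the third constant, `C / 0.234` pays for the index shift in `Te^[n+1] = Te ∘ To^[n]`. The
  -- other summands serve `n = 0`, where `volume_le_μe` bounds the volume and 1 accounts for `μe E`
  -- itself.
  refine ⟨⟨C, fun E hE _ n => ?_⟩, ⟨C, fun E hE _ n => ?_⟩,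
    ⟨Real.log Real.goldenRatio * (Real.goldenRatio + 1) + 1 + C / 0.234, fun E hE hsub n => ?_⟩⟩
  · have key := h _ (measurable_id.abs hE) n
    have hμ : 0 ≤ NICF.μ.real E := measureReal_nonneg
    simp only [Measure.real, id_eq] at key hμ ⊢
    rw [NICF.volume_preimage_T n hE, NICF.μo_preimage_abs hE, ENNReal.toReal_mul,
      ENNReal.toReal_ofNat] at key
    change |(volume (NICF.I ∩ NICF.T^[n] ⁻¹' E)).toReal - _| ≤ _
    have := mul_le_mul_of_nonneg_left (mul_le_mul_of_nonneg_left (rate n) hμ) hC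
    have hnn := (abs_nonneg _).trans key
    rw [abs_le] at key ⊢
    constructor <;> linarith [key.1, key.2]
  · exact (h E hE n).trans (mul_le_mul_of_nonneg_left
      (mul_le_mul_of_nonneg_left (rate n) measureReal_nonneg) hC)
  · have hl := NICF.log_golden_pos
    have hg := NICF.golden_bounds
    have hμ : 0 ≤ NICF.μe.real E := measureReal_nonneg
    cases n with
    | zero =>
      have e : NICF.iterPreimage NICF.Te NICF.I₀ 0 E = E := inter_eq_right.2 hsub
      have hfin : NICF.μe E ≠ ⊤ := by
        rw [← NICF.μo_preimage_Te hE hsub]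
        exact ((measure_mono (subset_univ _)).trans_lt (by simp [NICF.μo_univ])).ne
      have v := ENNReal.toReal_mono (ENNReal.mul_ne_top ENNReal.ofReal_ne_top hfin)
        (NICF.volume_le_μe hE hsub)
      rw [ENNReal.toReal_mul, ENNReal.toReal_ofReal (by positivity)] at v
      have hv : 0 ≤ volume.real E := measureReal_nonneg
      rw [e, pow_zero, mul_one, add_mul, add_mul, one_mul, abs_le]
      have h1 : 0 ≤ C / 0.234 * NICF.μe.real E := by positivity
      have h2 : 0 ≤ Real.log Real.goldenRatio * (Real.goldenRatio + 1) * NICF.μe.real E := by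
        positivity
      change volume.real E ≤ _ * NICF.μe.real E at v
      constructor <;> linarith
    | succ n =>
      have key := h _ (NICF.measurable_Te hE) n
      have e : NICF.iterPreimage NICF.Te NICF.I₀ (n + 1) E =
          NICF.I₀ ∩ NICF.To^[n] ⁻¹' (NICF.Te ⁻¹' E) := by
        ext x
        refine and_congr_right fun _ => ?_
        simp only [mem_preimage, NICF.Te_iterate_succ]
      rw [e]
      have e2 : NICF.μo.real (NICF.Te ⁻¹' E) = NICF.μe.real E := by
        rw [Measure.real, NICF.μo_preimage_Te hE hsub, Measure.real]
      rw [e2] at key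
      refine key.trans ?_
      have h1 : C * (NICF.μe.real E * 0.234 ^ n) =
          C / 0.234 * (NICF.μe.real E * 0.234 ^ (n + 1)) := by
        rw [pow_succ]
        ring
      rw [h1]
      refine mul_le_mul_of_nonneg_right ?_ (by positivity)
      have : 0 ≤ Real.log Real.goldenRatio * (Real.goldenRatio + 1) := by positivity
      linarith
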